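/- **Model.** SBSs and MBSs form independent homogeneous Poisson point processes in the plane with densities $\lambda_s,\lambda_m>0$; users have density $\lambda>0$, and the typical user sits at the origin. A link of length $r$ is LoS with probability $\mathcal P_L(r)=\min(18/r,1)(1-e^{-\beta r})+e^{-\beta r}$ ($\beta\ge 0$) and NLoS otherwise, and has path loss $L(r)=A_zr^{-\alpha_z}$, $A_z,\alpha_z>0$, $z\in\{L,NL\}$. All fading gains $h$ are exponential with mean $1$; positions, link types and fading are independent. For $k\in\{s,m\}$ the transmit power is $P_k^{tr}=(P_k^{tot}-P_k^{fc}-w_{ca}S_k)/\rho_k>0$ ($\rho_k>0$), where $S_s=C$ is the SBS cache capacity, $S_m=F\ge 1$ is the number of files and $C\le F$; $B_k>0$ is the bias factor of tier $k$, and $N_0>0$ is the noise power. The cache hit ratio is $p_h=\sum_{f=1}^{C}f^{-\gamma_p}/\sum_{g=1}^{F}g^{-\gamma_p}$, and $0<\eta<1$ is the fraction of bandwidth used for access. The user is associated with the SBS or MBS of largest biased mean received power $P_k^{tr}B_kL(r)$. The SINR of its access link, $\mathrm{SINR}_s$ or $\mathrm{SINR}_m$ according to the serving tier, is $P_k^{tr}B_khL(r)$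 of the serving station divided by $N_0$ plus the sum of the same quantity over all other stations of both tiers. The backhaul link is that of a typical SBS, independent of the access link: the SBS is associated with the strongest MBS (in mean received power) of a Poisson process of MBSs of density $\lambda_m$ around it, and $\mathrm{SINR}_{bh}$ is formed in the same way with MBSs only. The spectral efficiency of a user associated with an SBS is $$R_s=\min\Big\{\eta\log_2(1+\mathrm{SINR}_s),\ \tfrac{1-\eta}{1-p_h}\log_2(1+\mathrm{SINR}_{bh})\Big\}$$ (no backhaul constraint if $p_h=1$), and that of a user associated with an MBS is $R_m=\eta\log_2(1+\mathrm{SINR}_m)$. The area spectral efficiency $\mathcal A(\eta,C)$ is $\lambda$ times the expected spectral efficiency of the typical user; $\mathcal A_s(\eta,C)=\lambda\,\mathbb E[R_s;\ \text{associated with an SBS}]$ and $\mathcal A_m(\eta)=\lambda\,\mathbb E[R_m;\ \text{associated with an MBS}]$. All these are elements of $[0,\infty]$. For $z\in\{L,NL\}$ let $F_s^z$ (resp. $F_m^z$) be the density of the distance between the user and its serving station on the event that it is associated with an SBS (resp. MBS) by a link of type $z$; its integral is the probability of that event. Let $F_{bh}^z$ be the analogous density for the typical SBS and its serving MBS. For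 $k\in\{s,m,bh\}$ let $\mathbb P_{k,z}^{cov}(\gamma\mid r)$ be the conditional probability of $\mathrm{SINR}_k>\gamma$ given association by a link of type $z$ at serving distance $r$. Let $R_{s,1},R_{s,2},R_{s,3},R_{s,4}$ denote $R_s$ when the types $(z,z')$ of the access and backhaul links are $(L,L),(L,NL),(NL,L),(NL,NL)$, and let $R_{m,1},R_{m,2}$ denote $R_m$ when the access link is of type $z=L,NL$; their distributions below are conditional on the types and on the serving distances $r_s,r_{bh}$ or $r_m$. **Statement.** $\mathcal A(\eta,C)=\mathcal A_s(\eta,C)+\mathcal A_m(\eta)$, where $$\begin{aligned}\mathcal A_s(\eta,C)=\lambda\int_0^\infty\!\!\int_0^\infty\Big(&\Big[\int_0^\infty\mathbb P[R_{s,1}>\rho]\,d\rho\Big]F_s^L(r_s)F_{bh}^L(r_{bh})+\Big[\int_0^\infty\mathbb P[R_{s,2}>\rho]\,d\rho\Big]F_s^L(r_s)F_{bh}^{NL}(r_{bh})\\&+\Big[\int_0^\infty\mathbb P[R_{s,3}>\rho]\,d\rho\Big]F_s^{NL}(r_s)F_{bh}^L(r_{bh})+\Big[\int_0^\infty\mathbb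 P[R_{s,4}>\rho]\,d\rho\Big]F_s^{NL}(r_s)F_{bh}^{NL}(r_{bh})\Big)\,dr_s\,dr_{bh},\end{aligned}$$ $$\mathcal A_m(\eta)=\lambda\int_0^\infty\Big(\Big[\int_0^\infty\mathbb P[R_{m,1}>\rho]\,d\rho\Big]F_m^L(r_m)+\Big[\int_0^\infty\mathbb P[R_{m,2}>\rho]\,d\rho\Big]F_m^{NL}(r_m)\Big)\,dr_m.$$ Moreover, for every $\rho\ge 0$ and almost all serving distances (with respect to their law on the event in question), $$\mathbb P[R_{s,i}>\rho]=\mathbb P_{s,z}^{cov}\big(2^{\rho/\eta}-1\mid r_s\big)\,\mathbb P_{bh,z'}^{cov}\big(2^{(1-p_h)\rho/(1-\eta)}-1\mid r_{bh}\big),\qquad \mathbb P[R_{m,j}>\rho]=\mathbb P_{m,z}^{cov}\big(2^{\rho/\eta}-1\mid r_m\big),$$ where $(z,z')$ are the types of the $i$-th case and $z$ is the type of the $j$-th case. -/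

import Mathlib

open MeasureTheory ProbabilityTheory Set
open scoped ENNReal NNReal

noncomputable section

namespace CachedHetNet

/-- The plane in which base stations are deployed, with its Euclidean norm and Lebesgue measure. -/
abbrev Plane : Type := EuclideanSpace ℝ (Fin 2)

/-- The two tiers: small base stations and (high-power) MBSs. -/
inductive Tier
  | sbs
  | mbs

/-- Propagation condition of a radio link. -/
inductive Link
  | los
  | nlos

/-- The two kinds of receivers: the typical user (access link) and the typical SBS
(backhaul link).  Each of them sits at the origin of its own coordinate system. -/
inductive Receiver
  | user
  | smallCell

/-- The three families of base stations that are received: the SBSs and the MBSs as seen from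
the typical user, and the MBSs as seen from the typical SBS. -/
inductive Layer
  | accessSBS
  | accessMBS
  | backhaulMBS

def Layer.tier : Layer → Tier
  | .accessSBS => .sbs
  | .accessMBS => .mbs
  | .backhaulMBS => .mbs

def Layer.receiver : Layer → Receiver
  | .accessSBS => .user
  | .accessMBS => .user
  | .backhaulMBS => .smallCell

/-- Numerical parameters of the network. -/
structure Params where
  /-- densities `λ_s`, `λ_m` of the two tiers -/
  density : Tier → ℝ
  /-- density `λ` of the users -/
  userDensity : ℝ
  /-- path loss constants `A_L`, `A_NL` -/
  gain : Link → ℝ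
  /-- path loss exponents `α_L`, `α_NL` -/
  exponent : Link → ℝ
  /-- blockage parameter `β` -/
  blockage : ℝ
  /-- association bias factors `B_s`, `B_m` -/
  bias : Tier → ℝ
  /-- noise power `N₀` -/
  noise : ℝ
  /-- total powers of an SBS and of an MBS -/
  totalPower : Tier → ℝ
  /-- fixed circuit powers -/
  circuitPower : Tier → ℝ
  /-- power amplifier and cooling coefficients `ρ_s`, `ρ_m` -/
  amplifier : Tier → ℝ
  /-- caching power coefficient `w_ca` -/
  cachingPower : ℝ
  /-- number `F` of files in the library -/
  files : ℕ
  /-- cache capacity `C` of an SBS, in files -/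
  cache : ℕ
  /-- Zipf exponent `γ_p` -/
  zipf : ℝ
  /-- fraction `η` of the bandwidth that is allocated to the access links -/
  eta : ℝ

namespace Params

/-- Number of files stored by a base station: an MBS stores the whole library. -/
def storage (p : Params) : Tier → ℕ
  | .sbs => p.cache
  | .mbs => p.files

/-- Transmission power `P_k^tr`: what the circuits and the cache leave of the total power. -/
def txPower (p : Params) (k : Tier) : ℝ :=
  (p.totalPower k - p.circuitPower k - p.cachingPower * p.storage k) / p.amplifier k

/-- Cache hit ratio `p_h` of an SBS that stores the `C` most popular files. -/
def hitRatio (p : Params) : ℝ :=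
  (∑ f ∈ Finset.Icc 1 p.cache, (f : ℝ) ^ (-p.zipf)) /
    ∑ g ∈ Finset.Icc 1 p.files, (g : ℝ) ^ (-p.zipf)

/-- Probability `𝒫_L(r)` that a link of length `r` is LoS. -/
def losProb (p : Params) (r : ℝ) : ℝ :=
  min (18 / r) 1 * (1 - Real.exp (-p.blockage * r)) + Real.exp (-p.blockage * r)

/-- The standing assumptions on the parameters. -/
structure Valid (p : Params) : Prop where
  density_pos : ∀ k, 0 < p.density k
  userDensity_pos : 0 < p.userDensity
  gain_pos : ∀ z, 0 < p.gain z
  exponent_pos : ∀ z, 0 < p.exponent z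
  blockage_nonneg : 0 ≤ p.blockage
  bias_pos : ∀ k, 0 < p.bias k
  noise_pos : 0 < p.noise
  amplifier_pos : ∀ k, 0 < p.amplifier k
  power_left : ∀ k, p.circuitPower k + p.cachingPower * p.storage k < p.totalPower k
  files_pos : 0 < p.files
  cache_le : p.cache ≤ p.files
  eta_pos : 0 < p.eta
  eta_lt_one : p.eta < 1

end Params

section Model

variable {Ω : Type*} [MeasurableSpace Ω]

/-- Number of points of the random sequence `X` in `B`, for the outcome `ω`. -/
def count (X : ℕ → Ω → Plane) (B : Set Plane) (ω : Ω) : ℕ∞ :=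
  {i : ℕ | X i ω ∈ B}.encard

/-- `X` enumerates a homogeneous Poisson point process of density `c` in the plane. -/
structure IsPoissonProcess (μ : Measure Ω) (X : ℕ → Ω → Plane) (c : ℝ) : Prop where
  measurable : ∀ i, Measurable (X i)
  count_law : ∀ B : Set Plane, MeasurableSet B → volume B ≠ ∞ → ∀ n : ℕ,
    μ {ω | count X B ω = n} = poissonMeasure (c.toNNReal * (volume B).toNNReal) {n}
  count_indep : ∀ (n : ℕ) (B : Fin n → Set Plane), (∀ i, MeasurableSet (B i)) →
    Pairwise (fun i j => Disjoint (B i) (B j)) → iIndepFun (fun i => count X (B i)) μ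

/-- A realization of all the randomness of the network: the `i`-th base station of a layer has
a position relative to its receiver, a uniform mark that decides whether its link is blocked,
and a small-scale fading gain. -/
structure Network (Ω : Type*) where
  pos : Layer → ℕ → Ω → Plane
  mark : Layer → ℕ → Ω → ℝ
  fading : Layer → ℕ → Ω → ℝ

/-- The stochastic model: every layer is a Poisson process with the density of its tier, the
marks are uniform on `[0, 1]`, the fading gains are exponential of mean one (Rayleigh fading),
and everything is independent. -/
structure Network.IsPoisson (N : Network Ω) (μ : Measure Ω) (p : Params) : Prop where
  poisson : ∀ l, IsPoissonProcess μ (N.pos l) (p.density l.tier)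
  measurable_mark : ∀ l i, Measurable (N.mark l i)
  measurable_fading : ∀ l i, Measurable (N.fading l i)
  mark_law : ∀ l i, μ.map (N.mark l i) = volume.restrict (Icc (0 : ℝ) 1)
  fading_law : ∀ l i, μ.map (N.fading l i) = expMeasure 1
  indep_pos : iIndepFun (fun l ω i => N.pos l i ω) μ
  indep_mark : iIndepFun (fun (q : Layer × ℕ) => N.mark q.1 q.2) μ
  indep_fading : iIndepFun (fun (q : Layer × ℕ) => N.fading q.1 q.2) μ
  indep_pos_mark : IndepFun (fun ω (q : Layer × ℕ) => N.pos q.1 q.2 ω)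
    (fun ω (q : Layer × ℕ) => N.mark q.1 q.2 ω) μ
  indep_pos_mark_fading :
    IndepFun (fun ω => (fun (q : Layer × ℕ) => N.pos q.1 q.2 ω,
        fun (q : Layer × ℕ) => N.mark q.1 q.2 ω))
      (fun ω (q : Layer × ℕ) => N.fading q.1 q.2 ω) μ

/-- The base stations whose signal reaches the receiver `a`, be it as signal or as
interference. -/
abbrev Station (a : Receiver) : Type := {l : Layer // l.receiver = a} × ℕ

namespace Station

variable {a : Receiver}

def tier (b : Station a) : Tier := b.1.1.tier

/-- Distance between the receiver and the station. -/
def dist (N : Network Ω) (b : Station a) (ω : Ω) : ℝ := ‖N.pos b.1.1 b.2 ω‖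

open Classical in
/-- The link is LoS with probability `𝒫_L(r)`, where `r` is its length, and NLoS otherwise. -/
def link (p : Params) (N : Network Ω) (b : Station a) (ω : Ω) : Link :=
  if N.mark b.1.1 b.2 ω ≤ p.losProb (b.dist N ω) then .los else .nlos

/-- Biased mean received power `P_k^tr B_k A r ^ (-α)`. -/
def meanPower (p : Params) (N : Network Ω) (b : Station a) (ω : Ω) : ℝ :=
  p.txPower b.tier * p.bias b.tier *
    (p.gain (b.link p N ω) * b.dist N ω ^ (-p.exponent (b.link p N ω)))

/-- Biased received power `P_k^tr B_k h A r ^ (-α)`, with fading. -/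
def rxPower (p : Params) (N : Network Ω) (b : Station a) (ω : Ω) : ℝ≥0∞ :=
  ENNReal.ofReal (N.fading b.1.1 b.2 ω * b.meanPower p N ω)

/-- The station serves its receiver: it is the strongest one in biased mean received power. -/
def IsServing (p : Params) (N : Network Ω) (b : Station a) (ω : Ω) : Prop :=
  ∀ b' : Station a, b' ≠ b → b'.meanPower p N ω < b.meanPower p N ω

/-- Total power received from all the other stations. -/
def interference (p : Params) (N : Network Ω) (b : Station a) (ω : Ω) : ℝ≥0∞ :=
  ∑' b' : {b' : Station a // b' ≠ b}, b'.1.rxPower p N ω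

/-- Signal-to-interference-plus-noise ratio of the signal of the station. -/
def sinr (p : Params) (N : Network Ω) (b : Station a) (ω : Ω) : ℝ :=
  (b.rxPower p N ω / (b.interference p N ω + ENNReal.ofReal p.noise)).toReal

end Station

/-- The event that the receiver `a` is associated with the tier `k`. -/
def tierEvent (p : Params) (N : Network Ω) (a : Receiver) (k : Tier) : Set Ω :=
  {ω | ∃ b : Station a, b.IsServing p N ω ∧ b.tier = k}

/-- The event that the receiver `a` is associated with the tier `k` by a link of type `z`. -/
def linkEvent (p : Params) (N : Network Ω) (a : Receiver) (k : Tier) (z : Link) : Set Ω :=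
  {ω | ∃ b : Station a, b.IsServing p N ω ∧ b.tier = k ∧ b.link p N ω = z}

open Classical in
/-- Distance between the receiver and its serving station. -/
def servingDist (p : Params) (N : Network Ω) (a : Receiver) (ω : Ω) : ℝ :=
  if h : ∃ b : Station a, b.IsServing p N ω then (Classical.choose h).dist N ω else 0

open Classical in
/-- SINR of the signal of the serving station. -/
def servingSinr (p : Params) (N : Network Ω) (a : Receiver) (ω : Ω) : ℝ :=
  if h : ∃ b : Station a, b.IsServing p N ω then (Classical.choose h).sinr p N ω else 0

/-- Spectral efficiency `η log₂(1 + SINR)` of the access link. -/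
def accessEfficiency (p : Params) (N : Network Ω) (ω : Ω) : ℝ≥0∞ :=
  ENNReal.ofReal (p.eta * Real.logb 2 (1 + servingSinr p N .user ω))

/-- Spectral efficiency `(1 - η) log₂(1 + SINR_bh) / (1 - p_h)` that the backhaul link supports;
it is infinite if no file has to pass through the backhaul. -/
def backhaulEfficiency (p : Params) (N : Network Ω) (ω : Ω) : ℝ≥0∞ :=
  ENNReal.ofReal ((1 - p.eta) * Real.logb 2 (1 + servingSinr p N .smallCell ω)) /
    ENNReal.ofReal (1 - p.hitRatio)

/-- Spectral efficiency `R_k` of a user that is associated with the tier `k`. -/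
def efficiency (p : Params) (N : Network Ω) : Tier → Ω → ℝ≥0∞
  | .sbs => fun ω => min (accessEfficiency p N ω) (backhaulEfficiency p N ω)
  | .mbs => fun ω => accessEfficiency p N ω

open Classical in
/-- Spectral efficiency of the typical user, whatever the tier it is associated with. -/
def userEfficiency (p : Params) (N : Network Ω) (ω : Ω) : ℝ≥0∞ :=
  if ω ∈ tierEvent p N .user .sbs then efficiency p N .sbs ω
  else if ω ∈ tierEvent p N .user .mbs then efficiency p N .mbs ω
  else 0

/-- Area spectral efficiency `𝒜(η, C)`: user density times mean spectral efficiency. -/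
def ase (p : Params) (N : Network Ω) (μ : Measure Ω) : ℝ≥0∞ :=
  ENNReal.ofReal p.userDensity * ∫⁻ ω, userEfficiency p N ω ∂μ

/-- Area spectral efficiency of the tier `k`: the contribution `λ 𝔼[R_k]` of the users that are
associated with the tier `k`. -/
def tierAse (p : Params) (N : Network Ω) (μ : Measure Ω) (k : Tier) : ℝ≥0∞ :=
  ENNReal.ofReal p.userDensity * ∫⁻ ω in tierEvent p N .user k, efficiency p N k ω ∂μ

/-- Association density: the density, with respect to Lebesgue measure, of the serving distance
on the event that `a` is associated with the tier `k` by a link of type `z`.  Its integral is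
the probability of this event. -/
def assocDensity (p : Params) (N : Network Ω) (μ : Measure Ω) (a : Receiver) (k : Tier)
    (z : Link) : ℝ → ℝ≥0∞ :=
  ((μ.restrict (linkEvent p N a k z)).map (servingDist p N a)).rnDeriv volume

/-- `F_s^L`, `F_s^NL` -/
def densityS (p : Params) (N : Network Ω) (μ : Measure Ω) (z : Link) : ℝ → ℝ≥0∞ :=
  assocDensity p N μ .user .sbs z

/-- `F_m^L`, `F_m^NL` -/
def densityM (p : Params) (N : Network Ω) (μ : Measure Ω) (z : Link) : ℝ → ℝ≥0∞ :=
  assocDensity p N μ .user .mbs z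

/-- `F_bh^L`, `F_bh^NL` -/
def densityBh (p : Params) (N : Network Ω) (μ : Measure Ω) (z : Link) : ℝ → ℝ≥0∞ :=
  assocDensity p N μ .smallCell .mbs z

/-- Conditional SINR distribution `ℙ^cov(γ | r)`: the conditional probability that the SINR
exceeds `γ`, given that `a` is associated with the tier `k` by a link of type `z` and that the
serving distance is `r`. -/
def coverage (p : Params) (N : Network Ω) (μ : Measure Ω) [IsProbabilityMeasure μ]
    (a : Receiver) (k : Tier) (z : Link) (γ r : ℝ) : ℝ≥0∞ :=
  condDistrib (servingSinr p N a) (servingDist p N a) (μ.restrict (linkEvent p N a k z)) r (Ioi γ)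

/-- The event that the user is associated with the SBS tier by a link of type `z` and that the
backhaul link is of type `z'`. -/
def sbsCase (p : Params) (N : Network Ω) (z z' : Link) : Set Ω :=
  linkEvent p N .user .sbs z ∩ linkEvent p N .smallCell .mbs z'

/-- The pair `(r_s, r_bh)` of serving distances of the access link and of the backhaul link. -/
def distPair (p : Params) (N : Network Ω) (ω : Ω) : ℝ × ℝ :=
  (servingDist p N .user ω, servingDist p N .smallCell ω)

/-- Conditional spectral efficiency distribution of a user of the SBS tier: the probability of
`R_s > ρ`, given the types `z`, `z'` and the lengths `r.1`, `r.2` of the access link and of the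
backhaul link. -/
def tailS (p : Params) (N : Network Ω) (μ : Measure Ω) [IsProbabilityMeasure μ]
    (z z' : Link) (ρ : ℝ) (r : ℝ × ℝ) : ℝ≥0∞ :=
  condDistrib (efficiency p N .sbs) (distPair p N) (μ.restrict (sbsCase p N z z')) r
    (Ioi (ENNReal.ofReal ρ))

/-- Conditional spectral efficiency distribution of a user of the MBS tier: the probability of
`R_m > ρ`, given the type `z` and the length `r` of the access link. -/
def tailM (p : Params) (N : Network Ω) (μ : Measure Ω) [IsProbabilityMeasure μ]
    (z : Link) (ρ : ℝ) (r : ℝ) : ℝ≥0∞ :=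
  condDistrib (efficiency p N .mbs) (servingDist p N .user)
    (μ.restrict (linkEvent p N .user .mbs z)) r (Ioi (ENNReal.ofReal ρ))

end Model

end CachedHetNet

end

open CachedHetNet

/-! The theorem combines the layer cake formula, disintegration over the serving distances, and
independence of the networks around the two receivers; no coverage probability is computed. The mean
of an efficiency on an association event is the integral of its conditional tails against the law of
the serving distances (`lintegral_eq_lintegral_condDistrib_Ioi`). This law has a Lebesgue density on
the positive half-line (`withDensity_assocDensity`): a Poisson process almost surely has no point in
a given null set, and the norm pulls null sets of radii back to null sets of the plane. For the SBS
tier the law of the two distances is a product (`map_distPair`), because the access and backhaul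
quantities are measurable with respect to independent σ-algebras (`indep_receiverSigma`). The tail
identities are proved through uniqueness of densities. A conditional probability given the distance
is the density of the distance law restricted to the event (`withDensity_condDistrib`). The event
that the efficiency exceeds a level is an SINR event, or the intersection of one SINR event per
receiver, and in the latter case the restricted law factorizes. -/

/-! ### Layer cake formula and conditional laws as densities. -/

section Generic

/-- The layer cake formula for a measure on `[0, ∞]`. -/
theorem lintegral_Ioi_measure_Ioi_ofReal (ν : Measure ℝ≥0∞) [SFinite ν] :
    ∫⁻ ρ in Ioi (0 : ℝ), ν (Ioi (ENNReal.ofReal ρ)) = ∫⁻ x, x ∂ν := by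
  have hvol : ∀ x : ℝ≥0∞, ∫⁻ ρ in Ioi (0 : ℝ),
      {y : ℝ × ℝ≥0∞ | ENNReal.ofReal y.1 < y.2}.indicator 1 (ρ, x) = x := by
    intro x
    have hm : MeasurableSet {ρ : ℝ | ENNReal.ofReal ρ < x} :=
      measurableSet_lt ENNReal.measurable_ofReal measurable_const
    have : ∀ ρ : ℝ, {y : ℝ × ℝ≥0∞ | ENNReal.ofReal y.1 < y.2}.indicator (1 : ℝ × ℝ≥0∞ → ℝ≥0∞)
        (ρ, x) = {ρ : ℝ | ENNReal.ofReal ρ < x}.indicator 1 ρ := fun ρ => rfl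
    simp_rw [this]
    rw [lintegral_indicator_one hm, Measure.restrict_apply hm]
    -- The infinite value is treated apart, since `toReal` sends it to `0`.
    rcases eq_or_ne x ∞ with rfl | hx
    · simp
    · have : {ρ : ℝ | ENNReal.ofReal ρ < x} ∩ Ioi 0 = Ioo 0 x.toReal := by
        ext ρ
        simp only [mem_inter_iff, mem_ofPred_eq, mem_Ioi, mem_Ioo]
        constructor
        · rintro ⟨h1, h2⟩
          exact ⟨h2, (ENNReal.ofReal_lt_iff_lt_toReal h2.le hx).1 h1⟩
        · rintro ⟨h1, h2⟩
          exact ⟨(ENNReal.ofReal_lt_iff_lt_toReal h1.le hx).2 h2, h1⟩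
      rw [this, Real.volume_Ioo, sub_zero, ENNReal.ofReal_toReal hx]
  have hmeas : MeasurableSet {y : ℝ × ℝ≥0∞ | ENNReal.ofReal y.1 < y.2} :=
    measurableSet_lt (ENNReal.measurable_ofReal.comp measurable_fst) measurable_snd
  have hind : Measurable
      ({y : ℝ × ℝ≥0∞ | ENNReal.ofReal y.1 < y.2}.indicator (1 : ℝ × ℝ≥0∞ → ℝ≥0∞)) :=
    measurable_one.indicator hmeas
  calc ∫⁻ ρ in Ioi (0 : ℝ), ν (Ioi (ENNReal.ofReal ρ))
      = ∫⁻ ρ in Ioi (0 : ℝ), ∫⁻ x,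
          {y : ℝ × ℝ≥0∞ | ENNReal.ofReal y.1 < y.2}.indicator 1 (ρ, x) ∂ν := by
        refine lintegral_congr fun ρ => ?_
        rw [← lintegral_indicator_one measurableSet_Ioi]
        rfl
    _ = ∫⁻ x, (∫⁻ ρ in Ioi (0 : ℝ),
          {y : ℝ × ℝ≥0∞ | ENNReal.ofReal y.1 < y.2}.indicator 1 (ρ, x)) ∂ν :=
        lintegral_lintegral_swap hind.aemeasurable
    _ = ∫⁻ x, x ∂ν := lintegral_congr hvol

variable {Ω β γ : Type*} [MeasurableSpace Ω] [MeasurableSpace β] [MeasurableSpace γ]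

/-- The mean of `Y` is the integral of the tails of its conditional distribution. -/
theorem lintegral_eq_lintegral_condDistrib_Ioi (μ : Measure Ω) [IsFiniteMeasure μ]
    {X : Ω → β} {Y : Ω → ℝ≥0∞} (hX : Measurable X) (hY : Measurable Y) :
    ∫⁻ ω, Y ω ∂μ =
      ∫⁻ r, (∫⁻ ρ in Ioi (0 : ℝ), condDistrib Y X μ r (Ioi (ENNReal.ofReal ρ))) ∂(μ.map X) := by
  simp_rw [lintegral_Ioi_measure_Ioi_ofReal]
  rw [← Measure.lintegral_compProd (f := fun x : β × ℝ≥0∞ => x.2) measurable_snd,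
    compProd_map_condDistrib hY.aemeasurable, lintegral_map measurable_snd (hX.prodMk hY)]

theorem measurable_lintegral_condDistrib_Ioi (μ : Measure Ω) [IsFiniteMeasure μ]
    (X : Ω → β) (Y : Ω → ℝ≥0∞) :
    Measurable fun r => ∫⁻ ρ in Ioi (0 : ℝ), condDistrib Y X μ r (Ioi (ENNReal.ofReal ρ)) := by
  simp_rw [lintegral_Ioi_measure_Ioi_ofReal]
  exact measurable_id.lintegral_kernel

/-- The conditional probability of `Y ∈ s` given `X` is the density of the law of `X` on the event
`Y ∈ s` with respect to the law of `X`. -/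
theorem withDensity_condDistrib [StandardBorelSpace γ] [Nonempty γ] (μ : Measure Ω)
    [IsFiniteMeasure μ] {X : Ω → β} {Y : Ω → γ} (hX : Measurable X) (hY : Measurable Y)
    {s : Set γ} (hs : MeasurableSet s) :
    (μ.map X).withDensity (fun r => condDistrib Y X μ r s) = (μ.restrict (Y ⁻¹' s)).map X := by
  ext t ht
  rw [withDensity_apply _ ht, setLIntegral_map ht (Kernel.measurable_coe _ hs) hX,
    setLIntegral_preimage_condDistrib hX hY.aemeasurable hs ht, Measure.map_apply hX ht,
    Measure.restrict_apply (hX ht)]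

/-- Turns identities between conditional probabilities into identities between measures, where
independence can be used. -/
theorem ae_eq_of_withDensity_map_eq (μ : Measure Ω) [IsFiniteMeasure μ] {X : Ω → β}
    {f g : β → ℝ≥0∞} (hf : Measurable f) (hg : Measurable g)
    (h : (μ.map X).withDensity f = (μ.map X).withDensity g) : f =ᵐ[μ.map X] g :=
  (withDensity_eq_iff_of_sigmaFinite hf.aemeasurable hg.aemeasurable).1 h

end Generic

/-! ### Product laws and joins of independent σ-algebras. -/

section Independence

variable {Ω β γ : Type*} [MeasurableSpace β] [MeasurableSpace γ]

/-- On the intersection of two events of independent σ-algebras, random variables that are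
measurable with respect to these σ-algebras have a product law. -/
theorem map_prodMk_restrict_inter {m₁ m₂ mΩ : MeasurableSpace Ω} {μ : Measure Ω} [IsFiniteMeasure μ]
    (h : Indep m₁ m₂ μ) (h₁ : m₁ ≤ mΩ) (h₂ : m₂ ≤ mΩ)
    {E₁ E₂ : Set Ω} (hE₁ : MeasurableSet[m₁] E₁) (hE₂ : MeasurableSet[m₂] E₂)
    {X₁ : Ω → β} {X₂ : Ω → γ} (hX₁ : Measurable[m₁] X₁) (hX₂ : Measurable[m₂] X₂) :
    (μ.restrict (E₁ ∩ E₂)).map (fun ω => (X₁ ω, X₂ ω)) =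
      ((μ.restrict E₁).map X₁).prod ((μ.restrict E₂).map X₂) := by
  have hX₁' : Measurable X₁ := hX₁.mono h₁ le_rfl
  have hX₂' : Measurable X₂ := hX₂.mono h₂ le_rfl
  refine (Measure.prod_eq fun s t hs ht => ?_).symm
  rw [Measure.map_apply (hX₁'.prodMk hX₂') (hs.prod ht), Measure.map_apply hX₁' hs,
    Measure.map_apply hX₂' ht, Measure.restrict_apply ((hX₁'.prodMk hX₂') (hs.prod ht)),
    Measure.restrict_apply (hX₁' hs), Measure.restrict_apply (hX₂' ht),
    ← (Indep_iff _ _ _).1 h _ _ (MeasurableSet.inter (hX₁ hs) hE₁)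
      (MeasurableSet.inter (hX₂ ht) hE₂)]
  congr 1
  ext ω
  simp only [mem_inter_iff, mem_preimage, mem_prod]
  tauto

/-- With `isPiSystem_image2_inter`, this reduces independence of joins to a check on intersections
of one set from each σ-algebra. -/
theorem sup_eq_generateFrom_image2_inter (m₁ m₂ : MeasurableSpace Ω) :
    m₁ ⊔ m₂ = MeasurableSpace.generateFrom
      (image2 (· ∩ ·) {s | MeasurableSet[m₁] s} {s | MeasurableSet[m₂] s}) := by
  refine le_antisymm (sup_le ?_ ?_) (MeasurableSpace.generateFrom_le ?_)
  · intro s hs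
    exact MeasurableSpace.measurableSet_generateFrom
      ⟨s, hs, univ, @MeasurableSet.univ _ m₂, inter_univ s⟩
  · intro s hs
    exact MeasurableSpace.measurableSet_generateFrom
      ⟨univ, @MeasurableSet.univ _ m₁, s, hs, univ_inter s⟩
  · rintro _ ⟨s, hs, t, ht, rfl⟩
    have h₁ : m₁ ≤ m₁ ⊔ m₂ := le_sup_left
    have h₂ : m₂ ≤ m₁ ⊔ m₂ := le_sup_right
    exact MeasurableSet.inter (h₁ s hs) (h₂ t ht)

theorem isPiSystem_image2_inter (m₁ m₂ : MeasurableSpace Ω) :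
    IsPiSystem (image2 (· ∩ ·) {s | MeasurableSet[m₁] s} {s | MeasurableSet[m₂] s}) := by
  rintro _ ⟨s, hs, t, ht, rfl⟩ _ ⟨s', hs', t', ht', rfl⟩ -
  exact ⟨s ∩ s', MeasurableSet.inter hs hs', t ∩ t', MeasurableSet.inter ht ht',
    inter_inter_inter_comm _ _ _ _⟩

/-- Exchanges rows and columns of a 2 × 2 array: the model gives independence between kinds of
variables and, within each kind, between receivers; what is needed is independence between receivers
with the kinds joined. -/
theorem indep_sup_sup {m₁ m₂ m₃ m₄ mΩ : MeasurableSpace Ω} {μ : Measure Ω} [IsProbabilityMeasure μ]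
    (h₁ : m₁ ≤ mΩ) (h₂ : m₂ ≤ mΩ)
    (h₃ : m₃ ≤ mΩ) (h₄ : m₄ ≤ mΩ)
    (h₁₂ : Indep m₁ m₂ μ) (h₃₄ : Indep m₃ m₄ μ) (h : Indep (m₁ ⊔ m₂) (m₃ ⊔ m₄) μ) :
    Indep (m₁ ⊔ m₃) (m₂ ⊔ m₄) μ := by
  refine IndepSets.indep (sup_le h₁ h₃) (sup_le h₂ h₄) (isPiSystem_image2_inter m₁ m₃)
    (isPiSystem_image2_inter m₂ m₄) (sup_eq_generateFrom_image2_inter _ _)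
    (sup_eq_generateFrom_image2_inter _ _) ((IndepSets_iff _ _ _).2 ?_)
  rintro _ _ ⟨s₁, hs₁, s₃, hs₃, rfl⟩ ⟨s₂, hs₂, s₄, hs₄, rfl⟩
  have l₁ : m₁ ≤ m₁ ⊔ m₂ := le_sup_left
  have l₂ : m₂ ≤ m₁ ⊔ m₂ := le_sup_right
  have l₃ : m₃ ≤ m₃ ⊔ m₄ := le_sup_left
  have l₄ : m₄ ≤ m₃ ⊔ m₄ := le_sup_right
  have key := (Indep_iff _ _ _).1 h
  -- After this regrouping both sides split into the same four factors.
  have e : (s₁ ∩ s₃) ∩ (s₂ ∩ s₄) = (s₁ ∩ s₂) ∩ (s₃ ∩ s₄) := inter_inter_inter_comm _ _ _ _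
  change μ ((s₁ ∩ s₃) ∩ (s₂ ∩ s₄)) = μ (s₁ ∩ s₃) * μ (s₂ ∩ s₄)
  rw [e, key _ _ (MeasurableSet.inter (l₁ _ hs₁) (l₂ _ hs₂))
      (MeasurableSet.inter (l₃ _ hs₃) (l₄ _ hs₄)), key _ _ (l₁ _ hs₁) (l₃ _ hs₃),
    key _ _ (l₂ _ hs₂) (l₄ _ hs₄), (Indep_iff _ _ _).1 h₁₂ _ _ hs₁ hs₂,
    (Indep_iff _ _ _).1 h₃₄ _ _ hs₃ hs₄]
  ring

end Independence

namespace CachedHetNet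

instance : Finite Layer :=
  Finite.of_surjective (fun i : Fin 3 => ![Layer.accessSBS, .accessMBS, .backhaulMBS] i) (by
    rintro (_ | _ | _)
    exacts [⟨0, rfl⟩, ⟨1, rfl⟩, ⟨2, rfl⟩])

instance (a : Receiver) : Countable (Station a) := inferInstanceAs (Countable (_ × ℕ))

/-! ### Uniqueness of the serving station. -/

section Serving

variable {Ω : Type*} {p : Params} {N : Network Ω} {a : Receiver}

theorem link_eq_los_iff (b : Station a) (ω : Ω) :
    b.link p N ω = .los ↔ N.mark b.1.1 b.2 ω ≤ p.losProb (b.dist N ω) := by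
  unfold Station.link
  split_ifs with h <;> simp [h]

/-- The strict inequality in `IsServing` leaves at most one candidate, so the choice made in
`servingDist` and `servingSinr` is immaterial. -/
theorem Station.IsServing.unique {b b' : Station a} {ω : Ω} (hb : b.IsServing p N ω)
    (hb' : b'.IsServing p N ω) : b = b' := by
  by_contra hne
  exact lt_asymm (hb b' (Ne.symm hne)) (hb' b hne)

theorem servingDist_eq {b : Station a} {ω : Ω} (hb : b.IsServing p N ω) :
    servingDist p N a ω = b.dist N ω := by
  have h : ∃ b : Station a, b.IsServing p N ω := ⟨b, hb⟩
  rw [servingDist, dif_pos h, (Classical.choose_spec h).unique hb]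

theorem servingSinr_eq {b : Station a} {ω : Ω} (hb : b.IsServing p N ω) :
    servingSinr p N a ω = b.sinr p N ω := by
  have h : ∃ b : Station a, b.IsServing p N ω := ⟨b, hb⟩
  rw [servingSinr, dif_pos h, (Classical.choose_spec h).unique hb]

theorem servingSinr_nonneg (ω : Ω) : 0 ≤ servingSinr p N a ω := by
  unfold servingSinr
  split_ifs with h
  exacts [ENNReal.toReal_nonneg, le_rfl]

end Serving

/-! ### Measurability of the serving quantities. -/

section Measurability

variable {Ω : Type*} [MeasurableSpace Ω] {p : Params} {N : Network Ω} {a : Receiver}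

/-- The positions, marks and fading gains of the stations received by `a` are measurable. -/
structure Network.MeasurableAt (N : Network Ω) (a : Receiver) : Prop where
  pos : ∀ b : Station a, Measurable (N.pos b.1.1 b.2)
  mark : ∀ b : Station a, Measurable (N.mark b.1.1 b.2)
  fading : ∀ b : Station a, Measurable (N.fading b.1.1 b.2)

theorem Network.MeasurableAt.dist (h : N.MeasurableAt a) (b : Station a) :
    Measurable (b.dist N) :=
  (h.pos b).norm

theorem Params.measurable_losProb (p : Params) : Measurable p.losProb := by
  unfold Params.losProb
  fun_prop

theorem Network.MeasurableAt.measurableSet_link (h : N.MeasurableAt a) (b : Station a) (z : Link) :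
    MeasurableSet {ω | b.link p N ω = z} := by
  have hlos : MeasurableSet {ω | b.link p N ω = .los} := by
    simp_rw [link_eq_los_iff]
    exact measurableSet_le (h.mark b) (p.measurable_losProb.comp (h.dist b))
  cases z with
  | los => exact hlos
  | nlos =>
    convert hlos.compl using 1
    ext ω
    simp only [mem_ofPred_eq, mem_compl_iff]
    cases b.link p N ω <;> simp

theorem Network.MeasurableAt.meanPower (h : N.MeasurableAt a) (b : Station a) :
    Measurable (b.meanPower p N) := by
  have hz : ∀ z, Measurable fun ω => p.txPower b.tier * p.bias b.tier *
      (p.gain z * b.dist N ω ^ (-p.exponent z)) := fun z =>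
    (((h.dist b).pow_const _).const_mul _).const_mul _
  classical
  have key : Measurable fun ω => if b.link p N ω = .los then
      p.txPower b.tier * p.bias b.tier * (p.gain .los * b.dist N ω ^ (-p.exponent .los))
      else p.txPower b.tier * p.bias b.tier * (p.gain .nlos * b.dist N ω ^ (-p.exponent .nlos)) :=
    Measurable.ite (h.measurableSet_link (p := p) b .los) (hz .los) (hz .nlos)
  convert key using 1
  ext ω
  unfold Station.meanPower
  by_cases hl : b.link p N ω = .los
  · simp [hl]
  · have hl' : b.link p N ω = .nlos := by
      cases h : b.link p N ω
      exacts [absurd h hl, rfl]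
    simp [hl']

theorem Network.MeasurableAt.rxPower (h : N.MeasurableAt a) (b : Station a) :
    Measurable (b.rxPower p N) :=
  ((h.fading b).mul (h.meanPower b)).ennreal_ofReal

theorem Network.MeasurableAt.sinr (h : N.MeasurableAt a) (b : Station a) :
    Measurable (b.sinr p N) := by
  have : Measurable (b.interference p N) := Measurable.tsum fun b' => h.rxPower b'.1
  exact ((h.rxPower b).div (this.add_const _)).ennreal_toReal

theorem Network.MeasurableAt.measurableSet_isServing (h : N.MeasurableAt a) (b : Station a) :
    MeasurableSet {ω | b.IsServing p N ω} := by
  unfold Station.IsServing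
  simp only [ofPred_forall]
  exact MeasurableSet.iInter fun b' => MeasurableSet.iInter fun _ =>
    measurableSet_lt (h.meanPower b') (h.meanPower b)

theorem Network.MeasurableAt.measurableSet_tierEvent (h : N.MeasurableAt a) (k : Tier) :
    MeasurableSet (tierEvent p N a k) := by
  unfold tierEvent
  simp only [ofPred_exists]
  exact MeasurableSet.iUnion fun b => (h.measurableSet_isServing b).inter (.const _)

theorem Network.MeasurableAt.measurableSet_linkEvent (h : N.MeasurableAt a) (k : Tier) (z : Link) :
    MeasurableSet (linkEvent p N a k z) := by
  unfold linkEvent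
  simp only [ofPred_exists]
  exact MeasurableSet.iUnion fun b => (h.measurableSet_isServing b).inter
    ((MeasurableSet.const _).inter (h.measurableSet_link b z))

/-- Avoids measurability of the chosen station: countably many measurable events fix which station
serves, and off their union the default value is `0`. -/
theorem Network.MeasurableAt.measurable_of_eq_of_isServing (h : N.MeasurableAt a)
    {f : Ω → ℝ} {g : Station a → Ω → ℝ} (hg : ∀ b, Measurable (g b))
    (hs : ∀ b ω, b.IsServing p N ω → f ω = g b ω)
    (hn : ∀ ω, (¬ ∃ b : Station a, b.IsServing p N ω) → f ω = 0) : Measurable f := by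
  intro t ht
  have : f ⁻¹' t = (⋃ b : Station a, {ω | b.IsServing p N ω} ∩ g b ⁻¹' t) ∪
      ((⋃ b : Station a, {ω | b.IsServing p N ω})ᶜ ∩ {_ω | (0 : ℝ) ∈ t}) := by
    ext ω
    simp only [mem_preimage, mem_union, mem_iUnion, mem_inter_iff, mem_ofPred_eq, mem_compl_iff]
    by_cases hω : ∃ b : Station a, b.IsServing p N ω
    · obtain ⟨b, hb⟩ := hω
      rw [hs b ω hb]
      constructor
      · exact fun hm => .inl ⟨b, hb, hm⟩
      · rintro (⟨b', hb', hm⟩ | ⟨hm, -⟩)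
        · rwa [hb.unique hb']
        · exact absurd ⟨b, hb⟩ hm
    · rw [hn ω hω]
      constructor
      · exact fun hm => .inr ⟨hω, hm⟩
      · rintro (⟨b', hb', hm⟩ | ⟨-, hm⟩)
        · exact absurd ⟨b', hb'⟩ hω
        · exact hm
  rw [this]
  exact (MeasurableSet.iUnion fun b => (h.measurableSet_isServing b).inter (hg b ht)).union
    ((MeasurableSet.iUnion fun b => h.measurableSet_isServing b).compl.inter (.const _))

theorem Network.MeasurableAt.servingDist (h : N.MeasurableAt a) :
    Measurable (servingDist p N a) :=
  h.measurable_of_eq_of_isServing (fun b => h.dist b) (fun _ _ => servingDist_eq)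
    fun _ hω => dif_neg hω

theorem Network.MeasurableAt.servingSinr (h : N.MeasurableAt a) :
    Measurable (servingSinr p N a) :=
  h.measurable_of_eq_of_isServing (fun b => h.sinr (p := p) b) (fun _ _ => servingSinr_eq)
    fun _ hω => dif_neg hω

theorem Network.MeasurableAt.accessEfficiency (h : N.MeasurableAt .user) :
    Measurable (accessEfficiency p N) := by
  have := h.servingSinr (p := p)
  unfold CachedHetNet.accessEfficiency Real.logb
  fun_prop

theorem Network.MeasurableAt.backhaulEfficiency (h : N.MeasurableAt .smallCell) :
    Measurable (backhaulEfficiency p N) := by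
  have := h.servingSinr (p := p)
  unfold CachedHetNet.backhaulEfficiency Real.logb
  fun_prop

end Measurability

/-! ### Independence of the networks around the two receivers. -/

section Independence

variable {Ω : Type*}

/-- The σ-algebra generated by a family of random variables of the stations received by `a`. -/
abbrev familySigma {γ : Type*} [MeasurableSpace γ] (X : Layer → ℕ → Ω → γ) (a : Receiver) :
    MeasurableSpace Ω :=
  ⨆ b : Station a, MeasurableSpace.comap (X b.1.1 b.2) inferInstance

theorem measurable_familySigma {γ : Type*} [MeasurableSpace γ] (X : Layer → ℕ → Ω → γ)
    {a : Receiver} (b : Station a) : Measurable[familySigma X a] (X b.1.1 b.2) :=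
  (comap_measurable _).mono
    (le_iSup (fun b : Station a => MeasurableSpace.comap (X b.1.1 b.2) inferInstance) b) le_rfl

theorem familySigma_le {γ : Type*} [MeasurableSpace γ] [mΩ : MeasurableSpace Ω]
    {X : Layer → ℕ → Ω → γ} (hX : ∀ l i, Measurable (X l i)) (a : Receiver) :
    familySigma X a ≤ mΩ :=
  iSup_le fun _ => (hX _ _).comap_le

theorem familySigma_le_comap {γ : Type*} [MeasurableSpace γ] (X : Layer → ℕ → Ω → γ)
    (a : Receiver) : familySigma X a ≤
      MeasurableSpace.comap (fun ω (q : Layer × ℕ) => X q.1 q.2 ω) inferInstance := by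
  refine iSup_le fun b => Measurable.comap_le ?_
  exact (measurable_pi_apply (b.1.1, b.2)).comp
    (comap_measurable fun ω (q : Layer × ℕ) => X q.1 q.2 ω)

/-- The σ-algebra of everything that concerns the receiver `a`. -/
abbrev receiverSigma (N : Network Ω) (a : Receiver) : MeasurableSpace Ω :=
  (familySigma N.pos a ⊔ familySigma N.mark a) ⊔ familySigma N.fading a

/-- The measurability lemmas hold for any σ-algebra on `Ω`; through this instance they apply to the
information of a single receiver. -/
theorem measurableAt_receiverSigma (N : Network Ω) (a : Receiver) :
    @Network.MeasurableAt Ω (receiverSigma N a) N a :=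
  letI := receiverSigma N a
  { pos := fun b => (measurable_familySigma N.pos b).mono
      (le_sup_left.trans le_sup_left) le_rfl
    mark := fun b => (measurable_familySigma N.mark b).mono
      (le_sup_right.trans le_sup_left) le_rfl
    fading := fun b => (measurable_familySigma N.fading b).mono le_sup_right le_rfl }

variable [mΩ : MeasurableSpace Ω] {μ : Measure Ω} {p : Params} {N : Network Ω}

theorem Network.IsPoisson.measurableAt (hN : N.IsPoisson μ p) (a : Receiver) :
    N.MeasurableAt a where
  pos _ := (hN.poisson _).measurable _
  mark _ := hN.measurable_mark _ _
  fading _ := hN.measurable_fading _ _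

theorem Network.IsPoisson.receiverSigma_le (hN : N.IsPoisson μ p) (a : Receiver) :
    receiverSigma N a ≤ mΩ :=
  sup_le (sup_le (familySigma_le (fun l i => (hN.poisson l).measurable i) a)
    (familySigma_le hN.measurable_mark a)) (familySigma_le hN.measurable_fading a)

theorem indep_familySigma_of_iIndepFun {γ : Type*} [MeasurableSpace γ] {X : Layer → ℕ → Ω → γ}
    (hX : ∀ l i, Measurable (X l i)) (h : iIndepFun (fun q : Layer × ℕ => X q.1 q.2) μ) :
    Indep (familySigma X .user) (familySigma X .smallCell) μ := by
  have key := indep_iSup_of_disjoint (fun q : Layer × ℕ => (hX q.1 q.2).comap_le) h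
    (S := {q | q.1.receiver = .user}) (T := {q | q.1.receiver = .smallCell})
    (disjoint_left.2 fun q h₁ h₂ => by simp_all)
  refine indep_of_indep_of_le key ?_ ?_
  all_goals
    exact iSup_le fun b => le_iSup₂_of_le (b.1.1, b.2) b.1.2 le_rfl

/-- For positions: the points within a layer are not assumed independent of each other, so the
independent blocks are whole sequences, one per layer. -/
theorem indep_familySigma_of_iIndepFun_layer {γ : Type*} [MeasurableSpace γ]
    {X : Layer → ℕ → Ω → γ}
    (hX : ∀ l i, Measurable (X l i)) (h : iIndepFun (fun l ω i => X l i ω) μ) :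
    Indep (familySigma X .user) (familySigma X .smallCell) μ := by
  have key := indep_iSup_of_disjoint
    (fun l => (measurable_pi_lambda (fun ω i => X l i ω) (hX l)).comap_le) h
    (S := {l | l.receiver = .user}) (T := {l | l.receiver = .smallCell})
    (disjoint_left.2 fun q h₁ h₂ => by simp_all)
  have hle : ∀ (l : Layer) (i : ℕ), MeasurableSpace.comap (X l i) inferInstance ≤
      MeasurableSpace.comap (fun ω i => X l i ω) inferInstance := fun l i =>
    Measurable.comap_le ((measurable_pi_apply i).comp (comap_measurable fun ω i => X l i ω))
  refine indep_of_indep_of_le key ?_ ?_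
  all_goals
    exact iSup_le fun b => le_iSup₂_of_le b.1.1 b.1.2 (hle _ _)

/-- The network around the typical user is independent of the network around the typical SBS. -/
theorem Network.IsPoisson.indep_receiverSigma [IsProbabilityMeasure μ] (hN : N.IsPoisson μ p) :
    Indep (receiverSigma N .user) (receiverSigma N .smallCell) μ := by
  have mp := fun l i => (hN.poisson l).measurable i
  have lp := familySigma_le mp
  have lm := familySigma_le hN.measurable_mark
  have lf := familySigma_le hN.measurable_fading
  have cp := familySigma_le_comap N.pos
  have cm := familySigma_le_comap N.mark
  have cf := familySigma_le_comap N.fading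
  refine indep_sup_sup (sup_le (lp _) (lm _)) (sup_le (lp _) (lm _)) (lf _) (lf _)
    (indep_sup_sup (lp _) (lp _) (lm _) (lm _)
      (indep_familySigma_of_iIndepFun_layer mp hN.indep_pos)
      (indep_familySigma_of_iIndepFun hN.measurable_mark hN.indep_mark)
      (indep_of_indep_of_le hN.indep_pos_mark (sup_le (cp _) (cp _)) (sup_le (cm _) (cm _))))
    (indep_familySigma_of_iIndepFun hN.measurable_fading hN.indep_fading)
    (indep_of_indep_of_le hN.indep_pos_mark_fading ?_ (sup_le (cf _) (cf _)))
  have hj := comap_measurable (m := inferInstance) fun ω =>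
    (fun q : Layer × ℕ => N.pos q.1 q.2 ω, fun q : Layer × ℕ => N.mark q.1 q.2 ω)
  have hle := fun a => sup_le ((cp a).trans (measurable_fst.comp hj).comap_le)
    ((cm a).trans (measurable_snd.comp hj).comap_le)
  exact sup_le (hle _) (hle _)

end Independence

/-! ### Absolute continuity of the serving distance. -/

section Distance

/-- In polar coordinates the indicator of the preimage has a radial integrand that vanishes almost
everywhere. -/
theorem volume_preimage_norm_eq_zero {T : Set ℝ} (h0 : volume T = 0) :
    volume ((fun x : Plane => ‖x‖) ⁻¹' T) = 0 := by
  have hf : T.indicator (fun _ => (1 : ℝ)) =ᵐ[volume] 0 := indicator_meas_zero h0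
  have hg : (fun y : ℝ => y ^ (Module.finrank ℝ Plane - 1) • T.indicator (fun _ => (1 : ℝ)) y)
      =ᵐ[volume.restrict (Ioi 0)] 0 := by
    filter_upwards [ae_restrict_of_ae hf] with y hy
    simp [hy]
  -- Integrability is needed to pass from a zero Bochner integral to a function that is zero almost
  -- everywhere.
  have hint : Integrable (fun x : Plane => T.indicator (fun _ => (1 : ℝ)) ‖x‖) :=
    (integrable_fun_norm_addHaar volume).2 ((integrable_congr hg).2 (integrable_zero _ _ _))
  have hzero := integral_fun_norm_addHaar (volume : Measure Plane) (T.indicator fun _ => (1 : ℝ))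
  rw [integral_congr_ae hg] at hzero
  simp only [Pi.zero_apply, integral_zero, smul_zero] at hzero
  have hae := (integral_eq_zero_iff_of_nonneg (fun x => indicator_nonneg (by simp) _) hint).1 hzero
  refine measure_mono_null ?_ (mem_ae_iff.1 hae)
  intro x hx hx'
  have h1 : T.indicator (fun _ => (1 : ℝ)) ‖x‖ = 0 := hx'
  rw [indicator_of_mem (show ‖x‖ ∈ T from hx)] at h1
  exact one_ne_zero h1

variable {Ω : Type*} [MeasurableSpace Ω] {μ : Measure Ω} {p : Params} {N : Network Ω}

/-- The number of points in a null set is Poisson of mean `0`, hence almost surely zero. -/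
theorem IsPoissonProcess.measure_mem_eq_zero [IsProbabilityMeasure μ] {X : ℕ → Ω → Plane} {c : ℝ}
    (hX : IsPoissonProcess μ X c) {B : Set Plane} (hB : MeasurableSet B) (h0 : volume B = 0)
    (i : ℕ) : μ {ω | X i ω ∈ B} = 0 := by
  have h1 : μ {ω | count X B ω = (0 : ℕ)} = 1 := by
    rw [hX.count_law B hB (by simp [h0]) 0]
    simp [h0, poissonMeasure_singleton]
  have hset : {ω | count X B ω = (0 : ℕ)} = (⋃ i, {ω | X i ω ∈ B})ᶜ := by
    ext ω
    simp [count, Set.encard_eq_zero, Set.eq_empty_iff_forall_notMem]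
  have hm : MeasurableSet (⋃ i, {ω | X i ω ∈ B}) :=
    MeasurableSet.iUnion fun i => hX.measurable i hB
  rw [hset, prob_compl_eq_one_iff hm] at h1
  exact measure_mono_null (subset_iUnion (fun i => {ω | X i ω ∈ B}) i) h1

/-- The hypothesis concerns the preimage in the plane, not `T` itself, so that the nonpositive
half-line, which is not Lebesgue-null, is covered as well. -/
theorem Network.IsPoisson.map_servingDist_eq_zero [IsProbabilityMeasure μ]
    (hN : N.IsPoisson μ p) (a : Receiver) (k : Tier) (z : Link) {T : Set ℝ}
    (hT : MeasurableSet T) (h0 : volume ((fun x : Plane => ‖x‖) ⁻¹' T) = 0) :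
    (μ.restrict (linkEvent p N a k z)).map (servingDist p N a) T = 0 := by
  have h := hN.measurableAt a
  rw [Measure.map_apply h.servingDist hT, Measure.restrict_apply (h.servingDist hT)]
  have hnull : μ (⋃ b : Station a, {ω | N.pos b.1.1 b.2 ω ∈ (fun x : Plane => ‖x‖) ⁻¹' T}) = 0 :=
    measure_iUnion_null fun b =>
      (hN.poisson b.1.1).measure_mem_eq_zero (measurable_norm hT) h0 b.2
  refine measure_mono_null ?_ hnull
  rintro ω ⟨hω, b, hb, -⟩
  rw [mem_preimage, servingDist_eq hb] at hω
  exact mem_iUnion.2 ⟨b, hω⟩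

theorem Network.IsPoisson.map_servingDist_absolutelyContinuous [IsProbabilityMeasure μ]
    (hN : N.IsPoisson μ p) (a : Receiver) (k : Tier) (z : Link) :
    (μ.restrict (linkEvent p N a k z)).map (servingDist p N a) ≪ volume :=
  Measure.AbsolutelyContinuous.mk fun _ hT h0 =>
    hN.map_servingDist_eq_zero a k z hT (volume_preimage_norm_eq_zero h0)

/-- The association density is the density of the serving distance, which is positive. -/
theorem Network.IsPoisson.withDensity_assocDensity [IsProbabilityMeasure μ]
    (hN : N.IsPoisson μ p) (a : Receiver) (k : Tier) (z : Link) :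
    (volume.restrict (Ioi (0 : ℝ))).withDensity (assocDensity p N μ a k z) =
      (μ.restrict (linkEvent p N a k z)).map (servingDist p N a) := by
  have hpos : (μ.restrict (linkEvent p N a k z)).map (servingDist p N a) (Ioi 0)ᶜ = 0 := by
    refine hN.map_servingDist_eq_zero a k z measurableSet_Ioi.compl ?_
    convert measure_singleton (μ := volume) (0 : Plane)
    ext x
    simp
  rw [← restrict_withDensity measurableSet_Ioi, assocDensity,
    Measure.withDensity_rnDeriv_eq _ _ (hN.map_servingDist_absolutelyContinuous a k z)]
  exact Measure.restrict_eq_self_of_ae_mem (mem_ae_iff.2 hpos)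

end Distance

/-! ### Efficiency events and splitting by tier and link type. -/

section Efficiency

variable {Ω : Type*} {p : Params} {N : Network Ω}

theorem Params.hitRatio_le_one (hp : p.Valid) : p.hitRatio ≤ 1 := by
  refine div_le_one_of_le₀ ?_ (Finset.sum_nonneg fun _ _ => by positivity)
  exact Finset.sum_le_sum_of_subset_of_nonneg (Finset.Icc_subset_Icc le_rfl hp.cache_le)
    fun _ _ _ => by positivity

theorem lt_mul_logb_one_add_iff {c s : ℝ} (hc : 0 < c) (hs : 0 ≤ s) (ρ : ℝ) :
    ρ < c * Real.logb 2 (1 + s) ↔ (2 : ℝ) ^ (ρ / c) - 1 < s := by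
  rw [← div_lt_iff₀' hc, Real.lt_logb_iff_rpow_lt one_lt_two (by linarith), sub_lt_iff_lt_add']

theorem ofReal_lt_ofReal_iff_of_left_nonneg {x y : ℝ} (hx : 0 ≤ x) :
    ENNReal.ofReal x < ENNReal.ofReal y ↔ x < y := by
  rw [ENNReal.ofReal_lt_ofReal_iff']
  exact ⟨And.left, fun h => ⟨h, hx.trans_lt h⟩⟩

theorem lt_accessEfficiency_iff (hp : p.Valid) {ρ : ℝ} (hρ : 0 ≤ ρ) (ω : Ω) :
    ENNReal.ofReal ρ < accessEfficiency p N ω ↔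
      (2 : ℝ) ^ (ρ / p.eta) - 1 < servingSinr p N .user ω := by
  rw [accessEfficiency, ofReal_lt_ofReal_iff_of_left_nonneg hρ,
    lt_mul_logb_one_add_iff hp.eta_pos (servingSinr_nonneg ω)]

theorem lt_backhaulEfficiency_iff (hp : p.Valid) {ρ : ℝ} (hρ : 0 ≤ ρ) (ω : Ω) :
    ENNReal.ofReal ρ < backhaulEfficiency p N ω ↔
      (2 : ℝ) ^ ((1 - p.hitRatio) * ρ / (1 - p.eta)) - 1 < servingSinr p N .smallCell ω := by
  have hη : 0 < 1 - p.eta := sub_pos.2 hp.eta_lt_one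
  have hs := servingSinr_nonneg (p := p) (N := N) (a := .smallCell) ω
  rw [backhaulEfficiency, ← lt_mul_logb_one_add_iff hη hs]
  rcases (Params.hitRatio_le_one hp).lt_or_eq with h | h
  · have h' : 0 < 1 - p.hitRatio := sub_pos.2 h
    rw [← ENNReal.ofReal_div_of_pos h', ofReal_lt_ofReal_iff_of_left_nonneg hρ,
      lt_div_iff₀' h']
  -- When the hit ratio is one, the condition becomes positivity of the numerator: in `ℝ≥0∞`, a
  -- positive number over `0` is `∞`, and `0 / 0` is `0`.
  · rw [h, sub_self, zero_mul, ENNReal.ofReal_zero]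
    constructor
    · intro hlt
      by_contra hle
      rw [ENNReal.ofReal_of_nonpos (not_lt.1 hle), ENNReal.zero_div] at hlt
      exact not_lt_zero hlt
    · intro hlt
      rw [ENNReal.div_zero (ENNReal.ofReal_pos.2 hlt).ne']
      exact ENNReal.ofReal_lt_top

theorem preimage_accessEfficiency (hp : p.Valid) {ρ : ℝ} (hρ : 0 ≤ ρ) :
    accessEfficiency p N ⁻¹' Ioi (ENNReal.ofReal ρ) =
      servingSinr p N .user ⁻¹' Ioi ((2 : ℝ) ^ (ρ / p.eta) - 1) :=
  Set.ext fun ω => lt_accessEfficiency_iff hp hρ ω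

theorem preimage_efficiency_sbs (hp : p.Valid) {ρ : ℝ} (hρ : 0 ≤ ρ) :
    efficiency p N .sbs ⁻¹' Ioi (ENNReal.ofReal ρ) =
      servingSinr p N .user ⁻¹' Ioi ((2 : ℝ) ^ (ρ / p.eta) - 1) ∩
        servingSinr p N .smallCell ⁻¹'
          Ioi ((2 : ℝ) ^ ((1 - p.hitRatio) * ρ / (1 - p.eta)) - 1) :=
  Set.ext fun ω => lt_min_iff.trans
    (and_congr (lt_accessEfficiency_iff hp hρ ω) (lt_backhaulEfficiency_iff hp hρ ω))

theorem tierEvent_eq_union (a : Receiver) (k : Tier) :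
    tierEvent p N a k = linkEvent p N a k .los ∪ linkEvent p N a k .nlos := by
  ext ω
  constructor
  · rintro ⟨b, hb, hk⟩
    cases hz : b.link p N ω
    exacts [.inl ⟨b, hb, hk, hz⟩, .inr ⟨b, hb, hk, hz⟩]
  · rintro (⟨b, hb, hk, -⟩ | ⟨b, hb, hk, -⟩) <;> exact ⟨b, hb, hk⟩

theorem disjoint_linkEvent (a : Receiver) (k : Tier) :
    Disjoint (linkEvent p N a k .los) (linkEvent p N a k .nlos) := by
  refine disjoint_left.2 ?_
  rintro ω ⟨b, hb, -, hz⟩ ⟨b', hb', -, hz'⟩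
  rw [hb.unique hb', hz'] at hz
  cases hz

theorem disjoint_tierEvent (a : Receiver) :
    Disjoint (tierEvent p N a .sbs) (tierEvent p N a .mbs) := by
  refine disjoint_left.2 ?_
  rintro ω ⟨b, hb, hk⟩ ⟨b', hb', hk'⟩
  rw [hb.unique hb', hk'] at hk
  cases hk

theorem Station.tier_smallCell (b : Station .smallCell) : b.tier = .mbs := by
  obtain ⟨⟨l, hl⟩, i⟩ := b
  cases l
  · cases hl
  · cases hl
  · rfl

/-- The default SINR `0` gives a zero logarithm, and `0 / 0 = 0` covers hit ratio one. Outcomes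
without a serving MBS thus contribute nothing, and almost sure existence of one need not be shown.
-/
theorem efficiency_sbs_eq_zero {ω : Ω} (hω : ω ∉ tierEvent p N .smallCell .mbs) :
    efficiency p N .sbs ω = 0 := by
  have hs : servingSinr p N .smallCell ω = 0 :=
    dif_neg fun ⟨b, hb⟩ => hω ⟨b, hb, b.tier_smallCell⟩
  have hb : backhaulEfficiency p N ω = 0 := by
    simp [backhaulEfficiency, hs]
  exact nonpos_iff_eq_zero.1 ((min_le_right _ _).trans hb.le)

variable [MeasurableSpace Ω] {μ : Measure Ω}

theorem Network.IsPoisson.measurable_efficiency (hN : N.IsPoisson μ p) (k : Tier) :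
    Measurable (efficiency p N k) := by
  have h₁ := (hN.measurableAt .user).accessEfficiency (p := p)
  have h₂ := (hN.measurableAt .smallCell).backhaulEfficiency (p := p)
  cases k
  exacts [h₁.min h₂, h₁]

theorem Network.IsPoisson.measurable_distPair (hN : N.IsPoisson μ p) :
    Measurable (distPair p N) :=
  (hN.measurableAt .user).servingDist.prodMk (hN.measurableAt .smallCell).servingDist

theorem Network.IsPoisson.setLIntegral_tierEvent (hN : N.IsPoisson μ p) (a : Receiver) (k : Tier)
    (f : Ω → ℝ≥0∞) (ν : Measure Ω) :
    ∫⁻ ω in tierEvent p N a k, f ω ∂ν =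
      (∫⁻ ω in linkEvent p N a k .los, f ω ∂ν) + ∫⁻ ω in linkEvent p N a k .nlos, f ω ∂ν := by
  rw [tierEvent_eq_union,
    lintegral_union ((hN.measurableAt a).measurableSet_linkEvent k .nlos) (disjoint_linkEvent a k)]

theorem Network.IsPoisson.ase_eq_add (hN : N.IsPoisson μ p) :
    ase p N μ = tierAse p N μ .sbs + tierAse p N μ .mbs := by
  have hs := (hN.measurableAt .user).measurableSet_tierEvent (p := p) .sbs
  have hm := (hN.measurableAt .user).measurableSet_tierEvent (p := p) .mbs
  have hu : userEfficiency p N = fun ω =>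
      (tierEvent p N .user .sbs).indicator (efficiency p N .sbs) ω +
        (tierEvent p N .user .mbs).indicator (efficiency p N .mbs) ω := by
    ext ω
    unfold userEfficiency
    by_cases h₁ : ω ∈ tierEvent p N .user .sbs
    · have h₂ := disjoint_left.1 (disjoint_tierEvent _) h₁
      simp [h₁, h₂]
    · by_cases h₂ : ω ∈ tierEvent p N .user .mbs <;> simp [h₁, h₂]
  rw [ase, tierAse, tierAse, ← mul_add, hu,
    lintegral_add_left ((hN.measurable_efficiency .sbs).indicator hs), lintegral_indicator hs,
    lintegral_indicator hm]

theorem Network.IsPoisson.setLIntegral_linkEvent_efficiency_sbs (hN : N.IsPoisson μ p) (z : Link) :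
    ∫⁻ ω in linkEvent p N .user .sbs z, efficiency p N .sbs ω ∂μ =
      (∫⁻ ω in sbsCase p N z .los, efficiency p N .sbs ω ∂μ) +
        ∫⁻ ω in sbsCase p N z .nlos, efficiency p N .sbs ω ∂μ := by
  have hB := (hN.measurableAt .smallCell).measurableSet_tierEvent (p := p) .mbs
  have hl := (hN.measurableAt .smallCell).measurableSet_linkEvent (p := p) .mbs
  have h0 : ∫⁻ ω in (tierEvent p N .smallCell .mbs)ᶜ, efficiency p N .sbs ω
      ∂(μ.restrict (linkEvent p N .user .sbs z)) = 0 :=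
    setLIntegral_eq_zero hB.compl fun ω hω => efficiency_sbs_eq_zero hω
  rw [← lintegral_add_compl _ hB, h0, add_zero, hN.setLIntegral_tierEvent,
    Measure.restrict_restrict (hl _), Measure.restrict_restrict (hl _), inter_comm,
    inter_comm (linkEvent p N .smallCell .mbs .nlos)]
  rfl

theorem measurable_assocDensity (a : Receiver) (k : Tier) (z : Link) :
    Measurable (assocDensity p N μ a k z) :=
  Measure.measurable_rnDeriv _ _

end Efficiency

/-! ### Conditional tails and integral formulas. -/

section Tails

variable {Ω : Type*} [MeasurableSpace Ω] {μ : Measure Ω} [IsProbabilityMeasure μ] {p : Params}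
  {N : Network Ω}

theorem Network.IsPoisson.withDensity_coverage (hN : N.IsPoisson μ p) (a : Receiver) (k : Tier)
    (z : Link) (γ : ℝ) :
    ((μ.restrict (linkEvent p N a k z)).map (servingDist p N a)).withDensity
        (coverage p N μ a k z γ) =
      (μ.restrict (linkEvent p N a k z ∩ servingSinr p N a ⁻¹' Ioi γ)).map (servingDist p N a) := by
  have h := hN.measurableAt a
  rw [show coverage p N μ a k z γ = fun r => condDistrib (servingSinr p N a) (servingDist p N a)
      (μ.restrict (linkEvent p N a k z)) r (Ioi γ) from rfl,
    withDensity_condDistrib _ h.servingDist h.servingSinr measurableSet_Ioi,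
    Measure.restrict_restrict (h.servingSinr measurableSet_Ioi), inter_comm]

theorem measurable_coverage (a : Receiver) (k : Tier) (z : Link) (γ : ℝ) :
    Measurable (coverage p N μ a k z γ) :=
  Kernel.measurable_coe _ measurableSet_Ioi

/-- The serving distances of the access link and of the backhaul link are independent. -/
theorem Network.IsPoisson.map_distPair (hN : N.IsPoisson μ p) (z z' : Link) :
    (μ.restrict (sbsCase p N z z')).map (distPair p N) =
      ((μ.restrict (linkEvent p N .user .sbs z)).map (servingDist p N .user)).prod
        ((μ.restrict (linkEvent p N .smallCell .mbs z')).map (servingDist p N .smallCell)) := by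
  -- Measurability is taken in the receiver σ-algebras, not the ambient one, as
  -- `map_prodMk_restrict_inter` requires.
  have h₁ := @measurableAt_receiverSigma Ω N .user
  have h₂ := @measurableAt_receiverSigma Ω N .smallCell
  exact map_prodMk_restrict_inter hN.indep_receiverSigma (hN.receiverSigma_le _)
    (hN.receiverSigma_le _) (@Network.MeasurableAt.measurableSet_linkEvent _ (_) _ _ _ h₁ _ _)
    (@Network.MeasurableAt.measurableSet_linkEvent _ (_) _ _ _ h₂ _ _)
    (@Network.MeasurableAt.servingDist _ (_) _ _ _ h₁)
    (@Network.MeasurableAt.servingDist _ (_) _ _ _ h₂)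

theorem Network.IsPoisson.tailM_ae_eq (hp : p.Valid) (hN : N.IsPoisson μ p) (z : Link) {ρ : ℝ}
    (hρ : 0 ≤ ρ) :
    tailM p N μ z ρ =ᵐ[(μ.restrict (linkEvent p N .user .mbs z)).map (servingDist p N .user)]
      coverage p N μ .user .mbs z ((2 : ℝ) ^ (ρ / p.eta) - 1) := by
  have h := hN.measurableAt .user
  refine ae_eq_of_withDensity_map_eq _ (Kernel.measurable_coe _ measurableSet_Ioi)
    (measurable_coverage _ _ _ _) ?_
  rw [hN.withDensity_coverage]
  refine (withDensity_condDistrib _ h.servingDist (hN.measurable_efficiency .mbs)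
    measurableSet_Ioi).trans ?_
  rw [Measure.restrict_restrict (hN.measurable_efficiency .mbs measurableSet_Ioi), inter_comm]
  exact congrArg (fun s => (μ.restrict (_ ∩ s)).map _) (preimage_accessEfficiency hp hρ)

/-- Both sides are densities, relative to the law of the distance pair, of its law restricted to the
event that the efficiency exceeds `ρ`. This event pairs a user event with a small-cell event, so the
restricted law is a product whose factors have the two coverages as densities. -/
theorem Network.IsPoisson.tailS_ae_eq (hp : p.Valid) (hN : N.IsPoisson μ p) (z z' : Link) {ρ : ℝ}
    (hρ : 0 ≤ ρ) :
    tailS p N μ z z' ρ =ᵐ[(μ.restrict (sbsCase p N z z')).map (distPair p N)] fun r =>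
      coverage p N μ .user .sbs z ((2 : ℝ) ^ (ρ / p.eta) - 1) r.1 *
        coverage p N μ .smallCell .mbs z'
          ((2 : ℝ) ^ ((1 - p.hitRatio) * ρ / (1 - p.eta)) - 1) r.2 := by
  have h₁ := @measurableAt_receiverSigma Ω N .user
  have h₂ := @measurableAt_receiverSigma Ω N .smallCell
  refine ae_eq_of_withDensity_map_eq _ (Kernel.measurable_coe _ measurableSet_Ioi)
    (((measurable_coverage _ _ _ _).comp measurable_fst).mul
      ((measurable_coverage _ _ _ _).comp measurable_snd)) ?_
  refine (withDensity_condDistrib _ hN.measurable_distPair (hN.measurable_efficiency .sbs)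
    measurableSet_Ioi).trans ?_
  rw [Measure.restrict_restrict (hN.measurable_efficiency .sbs measurableSet_Ioi),
    preimage_efficiency_sbs hp hρ, inter_comm, sbsCase, inter_inter_inter_comm]
  refine (map_prodMk_restrict_inter hN.indep_receiverSigma (hN.receiverSigma_le _)
    (hN.receiverSigma_le _)
    (@MeasurableSet.inter _ (_) _ _
      (@Network.MeasurableAt.measurableSet_linkEvent _ (_) _ _ _ h₁ _ _)
      (@Network.MeasurableAt.servingSinr _ (_) _ _ _ h₁ _ measurableSet_Ioi))
    (@MeasurableSet.inter _ (_) _ _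
      (@Network.MeasurableAt.measurableSet_linkEvent _ (_) _ _ _ h₂ _ _)
      (@Network.MeasurableAt.servingSinr _ (_) _ _ _ h₂ _ measurableSet_Ioi))
    (@Network.MeasurableAt.servingDist _ (_) _ _ _ h₁)
    (@Network.MeasurableAt.servingDist _ (_) _ _ _ h₂)).trans ?_
  rw [← hN.withDensity_coverage, ← hN.withDensity_coverage,
    prod_withDensity (measurable_coverage _ _ _ _) (measurable_coverage _ _ _ _)]
  exact congrArg (Measure.withDensity · _) (hN.map_distPair z z').symm

theorem measurable_lintegral_tailS (z z' : Link) :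
    Measurable fun r => ∫⁻ ρ in Ioi (0 : ℝ), tailS p N μ z z' ρ r :=
  measurable_lintegral_condDistrib_Ioi _ _ _

theorem measurable_lintegral_tailM (z : Link) :
    Measurable fun r => ∫⁻ ρ in Ioi (0 : ℝ), tailM p N μ z ρ r :=
  measurable_lintegral_condDistrib_Ioi _ _ _

theorem Network.IsPoisson.setLIntegral_linkEvent_efficiency_mbs (hN : N.IsPoisson μ p) (z : Link) :
    ∫⁻ ω in linkEvent p N .user .mbs z, efficiency p N .mbs ω ∂μ =
      ∫⁻ r in Ioi (0 : ℝ), (∫⁻ ρ in Ioi (0 : ℝ), tailM p N μ z ρ r) * densityM p N μ z r := by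
  have h := hN.measurableAt .user
  have e : ∫⁻ ω in linkEvent p N .user .mbs z, efficiency p N .mbs ω ∂μ =
      ∫⁻ r, (∫⁻ ρ in Ioi (0 : ℝ), tailM p N μ z ρ r)
        ∂((μ.restrict (linkEvent p N .user .mbs z)).map (servingDist p N .user)) :=
    lintegral_eq_lintegral_condDistrib_Ioi _ h.servingDist (hN.measurable_efficiency .mbs)
  rw [e, ← hN.withDensity_assocDensity, lintegral_withDensity_eq_lintegral_mul _
    (measurable_assocDensity _ _ _) (measurable_lintegral_tailM z)]
  exact lintegral_congr fun r => mul_comm _ _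

theorem measurable_sbsIntegrand (z z' : Link) : Measurable fun r : ℝ × ℝ =>
    (∫⁻ ρ in Ioi (0 : ℝ), tailS p N μ z z' ρ r) * densityS p N μ z r.1 * densityBh p N μ z' r.2 :=
  ((measurable_lintegral_tailS z z').mul
    ((measurable_assocDensity _ _ _).comp measurable_fst)).mul
      ((measurable_assocDensity _ _ _).comp measurable_snd)

theorem Network.IsPoisson.setLIntegral_sbsCase_efficiency_sbs (hN : N.IsPoisson μ p)
    (z z' : Link) :
    ∫⁻ ω in sbsCase p N z z', efficiency p N .sbs ω ∂μ =
      ∫⁻ r' in Ioi (0 : ℝ), ∫⁻ r in Ioi (0 : ℝ),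
        (∫⁻ ρ in Ioi (0 : ℝ), tailS p N μ z z' ρ (r, r')) * densityS p N μ z r *
          densityBh p N μ z' r' := by
  have e : ∫⁻ ω in sbsCase p N z z', efficiency p N .sbs ω ∂μ =
      ∫⁻ r, (∫⁻ ρ in Ioi (0 : ℝ), tailS p N μ z z' ρ r)
        ∂((μ.restrict (sbsCase p N z z')).map (distPair p N)) :=
    lintegral_eq_lintegral_condDistrib_Ioi _ hN.measurable_distPair (hN.measurable_efficiency .sbs)
  have hd : Measurable fun r : ℝ × ℝ =>
      assocDensity p N μ .user .sbs z r.1 * assocDensity p N μ .smallCell .mbs z' r.2 :=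
    ((measurable_assocDensity _ _ _).comp measurable_fst).mul
      ((measurable_assocDensity _ _ _).comp measurable_snd)
  -- The product law has the product of the association densities on the open quadrant; the
  -- symmetric form of Tonelli puts the backhaul distance outside.
  rw [e, hN.map_distPair, ← hN.withDensity_assocDensity, ← hN.withDensity_assocDensity,
    prod_withDensity (measurable_assocDensity _ _ _) (measurable_assocDensity _ _ _),
    lintegral_withDensity_eq_lintegral_mul _ hd (measurable_lintegral_tailS z z'),
    ← lintegral_prod_symm _ (measurable_sbsIntegrand z z').aemeasurable]
  refine lintegral_congr fun r => ?_
  rw [mul_assoc]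
  exact mul_comm _ _

end Tails

end CachedHetNet

/-! ### Assembly of the four SBS cases and the two MBS cases. -/

theorem mainTheorem5 {Ω : Type*} [MeasurableSpace Ω] (μ : Measure Ω) [IsProbabilityMeasure μ]
    (p : Params) (hp : p.Valid) (N : Network Ω) (hN : N.IsPoisson μ p) :
    -- the two tiers
    ase p N μ = tierAse p N μ .sbs + tierAse p N μ .mbs ∧
    -- the SBS tier
    tierAse p N μ .sbs = ENNReal.ofReal p.userDensity *
      ∫⁻ r' in Ioi (0 : ℝ), ∫⁻ r in Ioi (0 : ℝ),
        ((∫⁻ ρ in Ioi (0 : ℝ), tailS p N μ .los .los ρ (r, r')) *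
            densityS p N μ .los r * densityBh p N μ .los r' +
          (∫⁻ ρ in Ioi (0 : ℝ), tailS p N μ .los .nlos ρ (r, r')) *
            densityS p N μ .los r * densityBh p N μ .nlos r' +
          (∫⁻ ρ in Ioi (0 : ℝ), tailS p N μ .nlos .los ρ (r, r')) *
            densityS p N μ .nlos r * densityBh p N μ .los r' +
          (∫⁻ ρ in Ioi (0 : ℝ), tailS p N μ .nlos .nlos ρ (r, r')) *
            densityS p N μ .nlos r * densityBh p N μ .nlos r') ∧
    -- the MBS tier
    tierAse p N μ .mbs = ENNReal.ofReal p.userDensity *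
      ∫⁻ r in Ioi (0 : ℝ),
        ((∫⁻ ρ in Ioi (0 : ℝ), tailM p N μ .los ρ r) * densityM p N μ .los r +
          (∫⁻ ρ in Ioi (0 : ℝ), tailM p N μ .nlos ρ r) * densityM p N μ .nlos r) ∧
    -- the conditional spectral efficiency distributions in the SBS tier
    (∀ (z z' : Link) (ρ : ℝ), 0 ≤ ρ →
      ∀ᵐ r ∂((μ.restrict (sbsCase p N z z')).map (distPair p N)),
        tailS p N μ z z' ρ r =
          coverage p N μ .user .sbs z ((2 : ℝ) ^ (ρ / p.eta) - 1) r.1 *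
            coverage p N μ .smallCell .mbs z'
              ((2 : ℝ) ^ ((1 - p.hitRatio) * ρ / (1 - p.eta)) - 1) r.2) ∧
    -- the conditional spectral efficiency distributions in the MBS tier
    (∀ (z : Link) (ρ : ℝ), 0 ≤ ρ →
      ∀ᵐ r ∂((μ.restrict (linkEvent p N .user .mbs z)).map (servingDist p N .user)),
        tailM p N μ z ρ r =
          coverage p N μ .user .mbs z ((2 : ℝ) ^ (ρ / p.eta) - 1) r) := by
  refine ⟨hN.ase_eq_add, ?_, ?_, fun z z' ρ hρ => hN.tailS_ae_eq hp z z' hρ,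
    fun z ρ hρ => hN.tailM_ae_eq hp z hρ⟩
  · rw [tierAse, hN.setLIntegral_tierEvent, hN.setLIntegral_linkEvent_efficiency_sbs,
      hN.setLIntegral_linkEvent_efficiency_sbs]
    simp only [hN.setLIntegral_sbsCase_efficiency_sbs]
    have hm := fun z z' => measurable_sbsIntegrand (μ := μ) (p := p) (N := N) z z'
    have hm₁ := fun z z' r' => (hm z z').comp (measurable_prodMk_right (y := r'))
    simp only [Function.comp_def] at hm₁
    have hm₂ := fun z z' => (hm z z').lintegral_prod_left' (μ := volume.restrict (Ioi (0 : ℝ)))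
    congr 1
    -- In the right-nested sum, merged from the inside out, each left summand is a single case, so
    -- only its measurability is needed.
    rw [add_assoc, ← lintegral_add_left (hm₂ .nlos .los), ← lintegral_add_left (hm₂ .los .nlos),
      ← lintegral_add_left (hm₂ .los .los)]
    refine lintegral_congr fun r' => ?_
    rw [← lintegral_add_left (hm₁ .nlos .los r'), ← lintegral_add_left (hm₁ .los .nlos r'),
      ← lintegral_add_left (hm₁ .los .los r')]
    refine lintegral_congr fun r => ?_
    simp only [add_assoc]
  · rw [tierAse, hN.setLIntegral_tierEvent, hN.setLIntegral_linkEvent_efficiency_mbs,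
      hN.setLIntegral_linkEvent_efficiency_mbs, ← lintegral_add_left]
    exact (measurable_lintegral_tailM _).mul (measurable_assocDensity _ _ _)
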